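/- Let $E$ be a finite set and let $X=(X_t)_{t\ge 0}$ be a right-continuous, time-homogeneous continuous-time Markov chain on $E$ with generator $Q=(Q(x,y))_{x,y\in E}$ and laws $(\mathbb P_x)_{x\in E}$, $\mathbb P_x(X_0=x)=1$. Let $\beta>0$ and let $\psi,\phi:E\to\mathbb R$ satisfy $0\le\psi\le\phi$. Let $\mathcal M$ be the set of all $[0,\infty]$-valued stopping times of the natural filtration of $X$, and for $\tau,\gamma\in\mathcal M$ and $x\in E$ put $$R_x(\tau,\gamma)=\mathbb E_x\big[e^{-\beta\tau}\psi(X_\tau)\mathbf 1_{\{\tau\le\gamma\}}+e^{-\beta\gamma}\phi(X_\gamma)\mathbf 1_{\{\tau>\gamma\}}\big],$$ where $e^{-\beta\eta}f(X_\eta)=0$ on $\{\eta=\infty\}$. For $A\subset E$ let $h(A)=\inf\{t\ge0: X_t\in A\}$ ($\inf\emptyset=\infty$), and for $f:E\to\mathbb R$ let $Q[f](x)=\sum_{y}Q(x,y)f(y)$. Define $V_0(x)=\sup_{\tau\in\mathcal M}\mathbb E_x[e^{-\beta\tau}\psi(X_\tau)]$, $$S_1=\{V_0>\phi\}\cup\{\phi=\psi\},\qquad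 S_{k+1}=\big(S_k\cap\{Q[V_k]-\beta V_k\ge0\}\big)\cup\{\phi=\psi\},\qquad V_k(x)=\sup_{\tau\in\mathcal M}R_x(\tau,h(S_k))\qquad(k\ge1).$$ For $k\ge1$ let $D_k=\bigcap_{n\ge1}D_k^{(n)}$, where $D_k^{(1)}=\{Q[\psi]-\beta\psi\le0\}\setminus S_k$ and, with $V_k^{(n)}(x)=R_x(h(D_k^{(n)}),h(S_k))$, $D_k^{(n+1)}=D_k^{(n)}\cap\{Q[V_k^{(n)}]-\beta V_k^{(n)}\le0\}$ for $n\ge1$. Finally let $D_\infty=\bigcup_{k\ge1}D_k$, $S_\infty=\bigcap_{k\ge1}S_k$ and $V_\infty(x)=\inf_{k\ge1}V_k(x)$. Then: 1. The pair $(\tau^*,\gamma^*)=\big(h(D_\infty\cup\{\phi=\psi\}),\,h(S_\infty)\big)$ is a Nash equilibrium: both are stopping times and $R_x(\tau,\gamma^*)\le R_x(\tau^*,\gamma^*)\le R_x(\tau^*,\gamma)$ for all $\tau,\gamma\in\mathcal M$ and $x\in E$. Moreover $\tau^*=h(D_\infty)\wedge h(\{\phi=\psi\})$. 2. The sequence $(V_k)_{k\ge1}$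 is decreasing and converges pointwise to $V_\infty$, and $V_\infty$ is the value $V$ of the game: $\sup_{\tau}\inf_{\gamma}R_x(\tau,\gamma)=V_\infty(x)=\inf_{\gamma}\sup_{\tau}R_x(\tau,\gamma)$ for all $x\in E$. 3. $V_\infty=\phi$ on $S_\infty$, and $V_\infty=\psi<\phi$ on $D_\infty$. 4. There is an integer $N\ge1$ such that $S_k=S_\infty$, $D_k=D_\infty$ and $V_k=V_\infty$ for all $k\ge N$; it can be chosen with $N<|E|$ if $|E|\ge2$, and $N=1$ if $|E|\le1$. -/

import Mathlib

open MeasureTheory Filter Topology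
open scoped NNReal Matrix

/-- A right-continuous, time-homogeneous continuous-time Markov chain `X` on a finite state space
`E`, with laws `P x` started at `x`, the Markov property with respect to its natural filtration
`σ(X_r, r ≤ t)`, and generator `Q` (the derivative at `0` of the transition matrices). -/
structure MarkovChain {E : Type*} (Ω : Type*) [Fintype E] [MeasurableSpace E]
    [mΩ : MeasurableSpace Ω] (Q : Matrix E E ℝ) where
  /-- the process -/
  X : ℝ≥0 → Ω → E
  /-- the law of the chain started at a given state -/
  P : E → Measure Ω
  measurable_X : ∀ t, Measurable (X t)
  /-- Every path is right-continuous for the discrete topology of `E`. -/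
  right_continuous : ∀ ω t, ∀ᶠ s in 𝓝[≥] t, X s ω = X t ω
  isProbabilityMeasure : ∀ x, IsProbabilityMeasure (P x)
  start : ∀ x, P x (X 0 ⁻¹' {x}) = 1
  /-- Markov property and time-homogeneity: conditionally on the past up to `t` and on `X_t = z`,
  the state after a further time `s` has the law of `X_s` under `P z`. -/
  markov : ∀ (x z y : E) (t s : ℝ≥0) (A : Set Ω),
    MeasurableSet[⨆ r ≤ t, MeasurableSpace.comap (X r) inferInstance] A →
      P x (A ∩ X t ⁻¹' {z} ∩ X (t + s) ⁻¹' {y}) = P x (A ∩ X t ⁻¹' {z}) * P z (X s ⁻¹' {y})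
  sum_row : ∀ x, ∑ y, Q x y = 0
  offDiag_nonneg : ∀ x y, x ≠ y → 0 ≤ Q x y
  generator : ∀ x y, HasDerivWithinAt (fun t : ℝ => (P x).real (X t.toNNReal ⁻¹' {y})) (Q x y)
    (Set.Ici 0) 0

namespace MarkovChain

variable {E Ω : Type*} [Fintype E] [MeasurableSpace E] [mΩ : MeasurableSpace Ω]
  {Q : Matrix E E ℝ} (M : MarkovChain Ω Q)

/-- The natural filtration `F_t = σ(X_s, s ≤ t)`. -/
def filtration : Filtration ℝ≥0 mΩ where
  seq t := ⨆ s ≤ t, MeasurableSpace.comap (M.X s) inferInstance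
  mono' _ _ h := iSup₂_le fun s hs =>
    le_iSup₂ (f := fun s _ => MeasurableSpace.comap (M.X s) inferInstance) s (hs.trans h)
  le' _ := iSup₂_le fun s _ => (M.measurable_X s).comap_le

/-- The set of all stopping times of the natural filtration, with values in `[0, ∞]`. -/
abbrev StopTime : Type _ := {τ : Ω → WithTop ℝ≥0 // IsStoppingTime M.filtration τ}

/-- The first hitting time `h(A) = inf {t ≥ 0 : X_t ∈ A}` (equal to `∞` if `A` is never hit). -/
noncomputable def hit (A : Set E) : Ω → WithTop ℝ≥0 := hittingAfter M.X A 0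

open Classical in
/-- `exp (-β τ) f(X_τ)`, with the convention that it is `0` on `{τ = ∞}`. -/
noncomputable def discounted (β : ℝ) (f : E → ℝ) (τ : Ω → WithTop ℝ≥0) (ω : Ω) : ℝ :=
  if τ ω = ⊤ then 0
  else Real.exp (-β * ((τ ω).untopD 0 : ℝ≥0)) * f (M.X ((τ ω).untopD 0) ω)

open Classical in
/-- The expected payoff
`R_x(τ, γ) = E_x[exp (-β τ) ψ(X_τ) 1_{τ ≤ γ} + exp (-β γ) φ(X_γ) 1_{τ > γ}]`. -/
noncomputable def payoff (β : ℝ) (ψ φ : E → ℝ) (τ γ : Ω → WithTop ℝ≥0) (x : E) : ℝ :=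
  ∫ ω, (if τ ω ≤ γ ω then M.discounted β ψ τ ω else M.discounted β φ γ ω) ∂(M.P x)

/-- The upper value `inf_γ sup_τ R_x(τ, γ)`. -/
noncomputable def upperValue (β : ℝ) (ψ φ : E → ℝ) (x : E) : ℝ :=
  ⨅ γ : M.StopTime, ⨆ τ : M.StopTime, M.payoff β ψ φ τ.1 γ.1 x

/-- The lower value `sup_τ inf_γ R_x(τ, γ)`. -/
noncomputable def lowerValue (β : ℝ) (ψ φ : E → ℝ) (x : E) : ℝ :=
  ⨆ τ : M.StopTime, ⨅ γ : M.StopTime, M.payoff β ψ φ τ.1 γ.1 x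

/-- A Nash equilibrium: a pair of stopping times that is a saddle point of `R_x` for every `x`. -/
def IsNashEquilibrium (β : ℝ) (ψ φ : E → ℝ) (τ' γ' : Ω → WithTop ℝ≥0) : Prop :=
  IsStoppingTime M.filtration τ' ∧ IsStoppingTime M.filtration γ' ∧
    ∀ τ γ : Ω → WithTop ℝ≥0, IsStoppingTime M.filtration τ → IsStoppingTime M.filtration γ →
      ∀ x, M.payoff β ψ φ τ γ' x ≤ M.payoff β ψ φ τ' γ' x ∧
        M.payoff β ψ φ τ' γ' x ≤ M.payoff β ψ φ τ' γ x

/-- The one-player value `V_0(x) = sup_τ E_x[exp (-β τ) ψ(X_τ)]`. -/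
noncomputable def onePlayerValue (β : ℝ) (ψ : E → ℝ) (x : E) : ℝ :=
  ⨆ τ : M.StopTime, ∫ ω, M.discounted β ψ τ.1 ω ∂(M.P x)

/-- `sup_τ R_x(τ, h(S))`. -/
noncomputable def bestResponse (β : ℝ) (ψ φ : E → ℝ) (S : Set E) (x : E) : ℝ :=
  ⨆ τ : M.StopTime, M.payoff β ψ φ τ.1 (M.hit S) x

/-- The sets `S_k` for `k ≥ 1` (the value at index `0` is a dummy):
`S_1 = {V_0 > φ} ∪ {φ = ψ}` and `S_{k+1} = (S_k ∩ {Q[V_k] - β V_k ≥ 0}) ∪ {φ = ψ}`,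
where `V_k(x) = sup_τ R_x(τ, h(S_k))`. -/
noncomputable def S (β : ℝ) (ψ φ : E → ℝ) : ℕ → Set E
  | 0 => ∅
  | 1 => {x | φ x < M.onePlayerValue β ψ x} ∪ {x | φ x = ψ x}
  | k + 2 => (S β ψ φ (k + 1) ∩
      {x | 0 ≤ (Q *ᵥ M.bestResponse β ψ φ (S β ψ φ (k + 1))) x
        - β * M.bestResponse β ψ φ (S β ψ φ (k + 1)) x}) ∪ {x | φ x = ψ x}

/-- `V_k(x) = sup_τ R_x(τ, h(S_k))`, for `k ≥ 1`. -/
noncomputable def V (β : ℝ) (ψ φ : E → ℝ) (k : ℕ) : E → ℝ :=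
  M.bestResponse β ψ φ (M.S β ψ φ k)

/-- The sets `D_k^{(n)}`, at index `n - 1` (that is, starting from `D_k^{(1)}` at index `0`):
`D_k^{(1)} = {Q[ψ] - β ψ ≤ 0} ∩ S_kᶜ` and
`D_k^{(n+1)} = {Q[V_k^{(n)}] - β V_k^{(n)} ≤ 0} ∩ D_k^{(n)}`,
where `V_k^{(n)}(x) = R_x(h(D_k^{(n)}), h(S_k))`. -/
noncomputable def innerD (β : ℝ) (ψ φ : E → ℝ) (k : ℕ) : ℕ → Set E
  | 0 => {x | (Q *ᵥ ψ) x - β * ψ x ≤ 0} ∩ (M.S β ψ φ k)ᶜ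
  | n + 1 =>
      {x | (Q *ᵥ M.payoff β ψ φ (M.hit (innerD β ψ φ k n)) (M.hit (M.S β ψ φ k))) x
        - β * M.payoff β ψ φ (M.hit (innerD β ψ φ k n)) (M.hit (M.S β ψ φ k)) x ≤ 0} ∩
      innerD β ψ φ k n

/-- `D_k = ⋂_n D_k^{(n)}`, for `k ≥ 1`. -/
noncomputable def D (β : ℝ) (ψ φ : E → ℝ) (k : ℕ) : Set E := ⋂ n, M.innerD β ψ φ k n

/-- `D_∞ = ⋃_{k ≥ 1} D_k`. -/
noncomputable def limD (β : ℝ) (ψ φ : E → ℝ) : Set E := ⋃ k ≥ 1, M.D β ψ φ k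

/-- `S_∞ = ⋂_{k ≥ 1} S_k`. -/
noncomputable def limS (β : ℝ) (ψ φ : E → ℝ) : Set E := ⋂ k ≥ 1, M.S β ψ φ k

/-- `V_∞(x) = inf_{k ≥ 1} V_k(x)`. -/
noncomputable def limV (β : ℝ) (ψ φ : E → ℝ) (x : E) : ℝ := ⨅ k : ℕ, M.V β ψ φ (k + 1) x

end MarkovChain

/-! Write L f = Q f - β f. Everything rests on verification: if L f ≤ 0 before τ ∧ γ and f dominates
the reward collected there, then R_x(τ, γ) ≤ f(x), and dually with all signs reversed (`payoff_le`,
`le_payoff`). This is optional stopping (`integral_discounted_le`), proved by sampling the path on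
grids: a step has error o(mesh), discounting keeps the total error o(1) uniformly in the horizon,
and right-continuity gives the limit.

For fixed S_k the inner iteration is policy improvement for stopping against h(S_k). Its sets
decrease in a finite set, so they stabilise; the resulting payoff majorises ψ and is superharmonic
(L f ≤ 0) off S_k. Hence it equals V_k, and D_k is the contact set {V_k = ψ} off S_k
(`exists_V_eq_innerV`, `mem_D_iff`).

The outer iteration drops from S_k the states with φ ≠ ψ and L V_k < 0, so V_k stays superharmonic
off S_{k+1} and V_{k+1} ≤ V_k ≤ φ (`V_succ_le`, `V_le`). Once S_{n+2} = S_{n+1}, also L V_{n+1} ≥ 0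
before τ*, which gives V_{n+1} ≤ R(τ*, γ) for every γ (`V_le_payoff_of_stationary`); R(τ, γ*) ≤
V_{n+1} holds by definition, so this is a saddle point. N < |E| because, if the iteration moves at
all, two states are never among those removed (`ncard_S_diff_add_two_le`). -/

set_option linter.unusedSectionVars false

namespace MarkovChain

variable {E Ω : Type*} [Fintype E] [MeasurableSpace E] [MeasurableSingletonClass E]
  [mΩ : MeasurableSpace Ω] {Q : Matrix E E ℝ} (M : MarkovChain Ω Q)

/-! ### Transition operators and the generator -/

instance (x : E) : IsProbabilityMeasure (M.P x) := M.isProbabilityMeasure x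

/-- The transition operators `(P_s f)(z) = E_z[f(X_s)]`. -/
noncomputable def transition (s : ℝ≥0) (f : E → ℝ) (z : E) : ℝ :=
  ∑ y, (M.P z).real (M.X s ⁻¹' {y}) * f y

/-- The discounted generator `L f = Q f - β f`. -/
def discountedGenerator (Q : Matrix E E ℝ) (β : ℝ) (f : E → ℝ) (x : E) : ℝ :=
  (Q *ᵥ f) x - β * f x

lemma setIntegral_comp_eq_sum (μ : Measure Ω) [IsFiniteMeasure μ] {Z : Ω → E} (hZ : Measurable Z)
    {A : Set Ω} (f : E → ℝ) :
    ∫ ω in A, f (Z ω) ∂μ = ∑ z, μ.real (A ∩ Z ⁻¹' {z}) * f z := by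
  have hf : Measurable f := measurable_of_finite f
  rw [← integral_map hZ.aemeasurable hf.aestronglyMeasurable, integral_fintype .of_finite]
  refine Finset.sum_congr rfl fun z _ => ?_
  rw [map_measureReal_apply hZ (measurableSet_singleton z),
    measureReal_restrict_apply (hZ (measurableSet_singleton z)), Set.inter_comm, smul_eq_mul]

lemma measureReal_eq_sum_inter (μ : Measure Ω) [IsFiniteMeasure μ] {Z : Ω → E}
    (hZ : Measurable Z) (B : Set Ω) :
    μ.real B = ∑ z, μ.real (B ∩ Z ⁻¹' {z}) := by
  simpa using setIntegral_comp_eq_sum μ hZ (A := B) (fun _ => (1 : ℝ))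

/-- With finitely many states, splitting over the values of X_t and X_{t+s} reduces this to the
Markov property on atoms. -/
lemma setIntegral_transition (x : E) (t s : ℝ≥0) (f : E → ℝ) {A : Set Ω}
    (hA : MeasurableSet[M.filtration t] A) :
    ∫ ω in A, f (M.X (t + s) ω) ∂(M.P x) = ∫ ω in A, M.transition s f (M.X t ω) ∂(M.P x) := by
  rw [setIntegral_comp_eq_sum _ (M.measurable_X _), setIntegral_comp_eq_sum _ (M.measurable_X _)]
  have h : ∀ z y, (M.P x).real (A ∩ M.X (t + s) ⁻¹' {y} ∩ M.X t ⁻¹' {z}) =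
      (M.P x).real (A ∩ M.X t ⁻¹' {z}) * (M.P z).real (M.X s ⁻¹' {y}) := fun z y => by
    rw [Set.inter_right_comm, measureReal_def, M.markov x z y t s A hA, ENNReal.toReal_mul]
    rfl
  simp_rw [transition, Finset.mul_sum]
  rw [Finset.sum_comm]
  refine Finset.sum_congr rfl fun y _ => ?_
  rw [measureReal_eq_sum_inter (M.P x) (M.measurable_X t), Finset.sum_mul]
  exact Finset.sum_congr rfl fun z _ => by rw [h, mul_assoc]

lemma ae_start (x : E) : ∀ᵐ ω ∂(M.P x), M.X 0 ω = x := by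
  have h := M.start x
  rwa [← mem_ae_iff_prob_eq_one (M.measurable_X 0 (measurableSet_singleton x))] at h

lemma transition_zero (f : E → ℝ) (z : E) : M.transition 0 f z = f z := by
  have h := setIntegral_comp_eq_sum (M.P z) (M.measurable_X 0) (A := Set.univ) f
  simp only [Set.univ_inter, Measure.restrict_univ] at h
  rw [transition, ← h, integral_congr_ae (g := fun _ => f z)]
  · simp
  · filter_upwards [M.ae_start z] with ω hω using by rw [hω]

lemma hasDerivWithinAt_exp_mul_transition (β : ℝ) (f : E → ℝ) (z : E) :
    HasDerivWithinAt (fun t : ℝ => Real.exp (-β * t) * M.transition t.toNNReal f z)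
      (discountedGenerator Q β f z) (Set.Ici 0) 0 := by
  have h1 : HasDerivWithinAt (fun t : ℝ => M.transition t.toNNReal f z)
      (∑ y, Q z y * f y) (Set.Ici 0) 0 := by
    have := HasDerivWithinAt.fun_sum (u := Finset.univ)
      fun y (_ : y ∈ Finset.univ) => (M.generator z y).mul_const (f y)
    exact this
  have h2 : HasDerivWithinAt (fun t : ℝ => Real.exp (-β * t)) (-β) (Set.Ici 0) 0 := by
    have := ((hasDerivAt_id (0 : ℝ)).const_mul (-β)).exp.hasDerivWithinAt (s := Set.Ici 0)
    simpa using this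
  have h3 := h2.mul h1
  have h0 : M.transition (Real.toNNReal 0) f z = f z := by
    rw [Real.toNNReal_zero, transition_zero]
  rw [h0] at h3
  refine h3.congr_deriv ?_
  simp only [discountedGenerator, Matrix.mulVec, dotProduct, mul_zero, Real.exp_zero]
  ring

lemma tendsto_slope_transition (β : ℝ) (f : E → ℝ) (z : E) :
    Tendsto (fun m : ℕ => ((m : ℝ) + 1) * (Real.exp (-β * (1 / ((m : ℝ) + 1))) *
      M.transition (1 / ((m : ℝ≥0) + 1)) f z - f z)) atTop (𝓝 (discountedGenerator Q β f z)) := by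
  have h := (hasDerivWithinAt_iff_tendsto_slope.1
    (M.hasDerivWithinAt_exp_mul_transition β f z))
  have h' : Tendsto (fun m : ℕ => (1 : ℝ) / ((m : ℝ) + 1)) atTop (𝓝[Set.Ici 0 \ {0}] 0) := by
    refine tendsto_nhdsWithin_iff.2 ⟨tendsto_one_div_add_atTop_nhds_zero_nat, .of_forall ?_⟩
    intro m
    have : (0 : ℝ) < 1 / ((m : ℝ) + 1) := by positivity
    exact ⟨this.le, this.ne'⟩
  refine (h.comp h').congr fun m => ?_
  have e : Real.toNNReal (1 / ((m : ℝ) + 1)) = 1 / ((m : ℝ≥0) + 1) := by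
    rw [Real.toNNReal_eq_iff_eq_coe (by positivity)]; push_cast; rfl
  simp only [Function.comp_apply, slope_def_field, e, Real.toNNReal_zero, transition_zero, mul_zero,
    Real.exp_zero, one_mul, sub_zero, div_div_eq_mul_div, div_one]
  ring

/-! ### Discounted paths sampled on time grids -/

lemma abs_le_sum_abs (f : E → ℝ) (z : E) : |f z| ≤ ∑ y, |f y| :=
  Finset.single_le_sum (f := fun y => |f y|) (fun _ _ => abs_nonneg _) (Finset.mem_univ z)

/-- The discounted process `exp (-β t) f(X_t)`. -/
noncomputable def discountedAt (β : ℝ) (f : E → ℝ) (t : ℝ≥0) (ω : Ω) : ℝ :=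
  Real.exp (-β * t) * f (M.X t ω)

lemma measurable_discountedAt (β : ℝ) (f : E → ℝ) (t : ℝ≥0) :
    Measurable (M.discountedAt β f t) :=
  ((measurable_of_finite f).comp (M.measurable_X t)).const_mul _

lemma abs_discountedAt_le {β : ℝ} (hβ : 0 < β) (f : E → ℝ) (t : ℝ≥0) (ω : Ω) :
    |M.discountedAt β f t ω| ≤ ∑ y, |f y| := by
  rw [discountedAt, abs_mul, Real.abs_exp]
  have h1 : Real.exp (-β * t) ≤ 1 := Real.exp_le_one_iff.2 (by
    have := mul_nonneg hβ.le t.2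
    linarith [show β * (t : ℝ) ≥ 0 from this])
  calc _ ≤ 1 * |f (M.X t ω)| := by gcongr
    _ ≤ _ := by rw [one_mul]; exact abs_le_sum_abs f _

lemma integrable_discountedAt {β : ℝ} (hβ : 0 < β) (f : E → ℝ) (t : ℝ≥0) (x : E) :
    Integrable (M.discountedAt β f t) (M.P x) :=
  .of_bound (M.measurable_discountedAt β f t).aestronglyMeasurable _
    (.of_forall fun ω => M.abs_discountedAt_le hβ f t ω)

/-- The mesh of the `m`-th time grid. -/
noncomputable def mesh (m : ℕ) : ℝ≥0 := 1 / ((m : ℝ≥0) + 1)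

open Classical in
/-- The discounted process sampled on the `m`-th time grid, stopped at the first grid point after
`τ` or at time `m + 1`, as a telescoping sum. -/
noncomputable def gridStopped (β : ℝ) (f : E → ℝ) (τ : Ω → WithTop ℝ≥0) (m : ℕ) (ω : Ω) : ℝ :=
  M.discountedAt β f 0 ω + ∑ k ∈ Finset.range ((m + 1) * (m + 1)),
    {ω | ((k * mesh m : ℝ≥0) : WithTop ℝ≥0) < τ ω}.indicator
      (fun ω => M.discountedAt β f ((k + 1 : ℕ) * mesh m) ω -
        M.discountedAt β f (k * mesh m) ω) ω

lemma measurableSet_coe_lt {τ : Ω → WithTop ℝ≥0} (hτ : IsStoppingTime M.filtration τ) (t : ℝ≥0) :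
    MeasurableSet {ω | (t : WithTop ℝ≥0) < τ ω} :=
  M.filtration.le t _ (hτ.measurableSet_gt t)

lemma measurable_gridStopped (β : ℝ) (f : E → ℝ) {τ : Ω → WithTop ℝ≥0}
    (hτ : IsStoppingTime M.filtration τ) (m : ℕ) : Measurable (M.gridStopped β f τ m) := by
  refine (M.measurable_discountedAt β f 0).add (Finset.measurable_sum _ fun k _ => ?_)
  exact ((M.measurable_discountedAt β f _).sub (M.measurable_discountedAt β f _)).indicator
    (M.measurableSet_coe_lt hτ _)

/-- The hypothesis says that the grid times before τ are exactly the first j, so the sum telescopes.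
-/
lemma gridStopped_eq (β : ℝ) (f : E → ℝ) (τ : Ω → WithTop ℝ≥0) (m : ℕ) (ω : Ω) {j : ℕ}
    (hj : j ≤ (m + 1) * (m + 1))
    (h : ∀ k < (m + 1) * (m + 1), ((k * mesh m : ℝ≥0) : WithTop ℝ≥0) < τ ω ↔ k < j) :
    M.gridStopped β f τ m ω = M.discountedAt β f (j * mesh m) ω := by
  classical
  have h1 : ∀ k ∈ Finset.range ((m + 1) * (m + 1)),
      {ω | ((k * mesh m : ℝ≥0) : WithTop ℝ≥0) < τ ω}.indicator
        (fun ω => M.discountedAt β f ((k + 1 : ℕ) * mesh m) ω -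
          M.discountedAt β f (k * mesh m) ω) ω =
      if k < j then M.discountedAt β f ((k + 1 : ℕ) * mesh m) ω -
          M.discountedAt β f (k * mesh m) ω else 0 := fun k hk => by
    have hk' := h k (Finset.mem_range.1 hk)
    simp only [Set.indicator_apply, Set.mem_ofPred_eq, hk']
  have h2 : (Finset.range ((m + 1) * (m + 1))).filter (· < j) = Finset.range j := by
    ext k; simp only [Finset.mem_filter, Finset.mem_range]; omega
  rw [gridStopped, Finset.sum_congr rfl h1, ← Finset.sum_filter, h2,
    Finset.sum_range_sub (fun k : ℕ => M.discountedAt β f (k * mesh m) ω)]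
  simp

lemma coe_mul_mesh_lt_iff (k m : ℕ) (t : ℝ≥0) :
    ((k * mesh m : ℝ≥0) : WithTop ℝ≥0) < (t : WithTop ℝ≥0) ↔ k < ⌈t * (m + 1)⌉₊ := by
  rw [WithTop.coe_lt_coe, Nat.lt_ceil, mesh, mul_one_div, div_lt_iff₀ (by positivity)]

lemma exists_gridStopped_eq (β : ℝ) (f : E → ℝ) (τ : Ω → WithTop ℝ≥0) (m : ℕ) (ω : Ω) :
    ∃ j : ℕ, M.gridStopped β f τ m ω = M.discountedAt β f (j * mesh m) ω := by
  induction h : τ ω with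
  | top => exact ⟨_, M.gridStopped_eq β f τ m ω le_rfl fun k hk => by
      rw [h]; exact iff_of_true (WithTop.coe_lt_top _) hk⟩
  | coe t => exact ⟨_, M.gridStopped_eq β f τ m ω (min_le_right ⌈t * (m + 1)⌉₊ _) fun k hk => by
      rw [h, coe_mul_mesh_lt_iff, lt_min_iff, and_iff_left hk]⟩

lemma abs_gridStopped_le {β : ℝ} (hβ : 0 < β) (f : E → ℝ) (τ : Ω → WithTop ℝ≥0) (m : ℕ) (ω : Ω) :
    |M.gridStopped β f τ m ω| ≤ ∑ y, |f y| := by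
  obtain ⟨j, hj⟩ := M.exists_gridStopped_eq β f τ m ω
  rw [hj]
  exact M.abs_discountedAt_le hβ f _ ω

lemma tendsto_mesh : Tendsto mesh atTop (𝓝 0) := by
  rw [← NNReal.tendsto_coe]
  simpa [mesh] using tendsto_one_div_add_atTop_nhds_zero_nat (𝕜 := ℝ)

lemma tendsto_gridStopped {β : ℝ} (hβ : 0 < β) (f : E → ℝ) (τ : Ω → WithTop ℝ≥0) (ω : Ω) :
    Tendsto (fun m => M.gridStopped β f τ m ω) atTop (𝓝 (M.discounted β f τ ω)) := by
  induction h : τ ω with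
  | top =>
    -- If τ = ∞ the sample is taken at the horizon m + 1, where the discount factor tends to 0.
    have h1 : ∀ m : ℕ, M.gridStopped β f τ m ω = M.discountedAt β f ((m : ℝ≥0) + 1) ω := by
      intro m
      rw [M.gridStopped_eq β f τ m ω le_rfl fun k hk => by
        rw [h]; exact iff_of_true (WithTop.coe_lt_top _) hk]
      congr 1
      rw [mesh]
      push_cast
      field_simp
    simp only [h1, discounted, h, if_true]
    have h2 : Tendsto (fun m : ℕ => Real.exp (-β * ((m : ℝ) + 1)) * ∑ y, |f y|) atTop (𝓝 0) := by
      rw [← zero_mul (∑ y, |f y|)]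
      refine Tendsto.mul_const _ (Real.tendsto_exp_atBot.comp ?_)
      exact Tendsto.const_mul_atTop_of_neg (by linarith)
        (tendsto_atTop_add_const_right _ _ tendsto_natCast_atTop_atTop)
    refine squeeze_zero_norm (fun m => ?_) h2
    rw [discountedAt, norm_mul, Real.norm_eq_abs, Real.abs_exp]
    push_cast
    gcongr
    exact abs_le_sum_abs f _
  | coe t =>
    have hd : M.discounted β f τ ω = M.discountedAt β f t ω := by
      rw [discounted, if_neg (by rw [h]; exact WithTop.coe_ne_top), h]; rfl
    have h1 : ∀ᶠ m : ℕ in atTop, M.discountedAt β f (⌈t * (m + 1)⌉₊ * mesh m) ω =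
        M.gridStopped β f τ m ω := by
      -- For m ≥ t the horizon m + 1 no longer truncates the sample; the grid times then approach t
      -- from the right, as right-continuity requires.
      filter_upwards [eventually_ge_atTop ⌈t⌉₊] with m hm
      have hle : ⌈t * (m + 1)⌉₊ ≤ (m + 1) * (m + 1) := by
        rw [Nat.ceil_le]
        have : t ≤ m := (Nat.le_ceil t).trans (mod_cast hm)
        push_cast
        gcongr
        exact this.trans (by simp)
      exact (M.gridStopped_eq β f τ m ω hle fun k _ => by rw [h, coe_mul_mesh_lt_iff]).symm
    have hge : ∀ m : ℕ, t ≤ ⌈t * (m + 1)⌉₊ * mesh m := fun m => by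
      rw [mesh, mul_one_div, le_div_iff₀ (by positivity)]
      exact Nat.le_ceil _
    have hle : ∀ m : ℕ, ⌈t * (m + 1)⌉₊ * mesh m ≤ t + mesh m := fun m => by
      rw [mesh, mul_one_div, div_le_iff₀ (by positivity), add_mul,
        one_div_mul_cancel (by positivity)]
      exact (Nat.ceil_lt_add_one (by positivity)).le
    have hlim : Tendsto (fun m : ℕ => ⌈t * (m + 1)⌉₊ * mesh m) atTop (𝓝[≥] t) := by
      refine tendsto_nhdsWithin_iff.2 ⟨?_, .of_forall hge⟩
      refine tendsto_of_tendsto_of_tendsto_of_le_of_le tendsto_const_nhds ?_ hge hle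
      simpa using tendsto_mesh.const_add t
    refine Tendsto.congr' h1 ?_
    rw [hd]
    refine Tendsto.mul ?_ ?_
    · exact (Real.continuous_exp.tendsto _).comp ((((NNReal.continuous_coe.tendsto t).comp
        (hlim.mono_right nhdsWithin_le_nhds))).const_mul (-β))
    · refine tendsto_const_nhds.congr' ?_
      filter_upwards [hlim.eventually (M.right_continuous ω t)] with m hm using by rw [hm]

lemma measurable_discounted {β : ℝ} (hβ : 0 < β) (f : E → ℝ) {τ : Ω → WithTop ℝ≥0}
    (hτ : IsStoppingTime M.filtration τ) : Measurable (M.discounted β f τ) :=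
  measurable_of_tendsto_metrizable (M.measurable_gridStopped β f hτ)
    (tendsto_pi_nhds.2 fun ω => M.tendsto_gridStopped hβ f τ ω)

lemma abs_discounted_le {β : ℝ} (hβ : 0 < β) (f : E → ℝ) (τ : Ω → WithTop ℝ≥0) (ω : Ω) :
    |M.discounted β f τ ω| ≤ ∑ y, |f y| :=
  le_of_tendsto (M.tendsto_gridStopped hβ f τ ω).abs
    (.of_forall fun m => M.abs_gridStopped_le hβ f τ m ω)

lemma integrable_discounted {β : ℝ} (hβ : 0 < β) (f : E → ℝ) {τ : Ω → WithTop ℝ≥0}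
    (hτ : IsStoppingTime M.filtration τ) (x : E) : Integrable (M.discounted β f τ) (M.P x) :=
  .of_bound (M.measurable_discounted hβ f hτ).aestronglyMeasurable _
    (.of_forall fun ω => M.abs_discounted_le hβ f τ ω)

/-! ### Optional stopping -/

/-- The total deviation of the difference quotient of the discounted semigroup on the `m`-th
grid from the discounted generator. -/
noncomputable def slopeError (β : ℝ) (f : E → ℝ) (m : ℕ) : ℝ :=
  ∑ z, |((m : ℝ) + 1) * (Real.exp (-β * (1 / ((m : ℝ) + 1))) * M.transition (mesh m) f z - f z) -
    discountedGenerator Q β f z|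

lemma tendsto_slopeError (β : ℝ) (f : E → ℝ) :
    Tendsto (M.slopeError β f) atTop (𝓝 0) := by
  rw [← Finset.sum_const_zero (s := (Finset.univ : Finset E))]
  refine tendsto_finsetSum _ fun z _ => ?_
  have := ((M.tendsto_slope_transition β f z).sub_const (discountedGenerator Q β f z)).abs
  rw [sub_self, abs_zero] at this
  exact this

lemma transition_step_le (β : ℝ) (f : E → ℝ) (m : ℕ) {z : E}
    (hz : discountedGenerator Q β f z ≤ 0) :
    Real.exp (-β * (1 / ((m : ℝ) + 1))) * M.transition (mesh m) f z - f z ≤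
      1 / ((m : ℝ) + 1) * M.slopeError β f m := by
  have h : |((m : ℝ) + 1) * (Real.exp (-β * (1 / ((m : ℝ) + 1))) * M.transition (mesh m) f z -
      f z) - discountedGenerator Q β f z| ≤ M.slopeError β f m :=
    Finset.single_le_sum (f := fun z => |((m : ℝ) + 1) *
      (Real.exp (-β * (1 / ((m : ℝ) + 1))) * M.transition (mesh m) f z - f z) -
        discountedGenerator Q β f z|) (fun _ _ => abs_nonneg _) (Finset.mem_univ z)
  have h' := (le_abs_self _).trans h
  rw [one_div_mul_eq_div, le_div_iff₀ (by positivity)]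
  linarith

/-- The event that τ has not yet occurred belongs to the past of the grid time, so the Markov
property applies on it. The factor r ^ k is kept so that the errors sum geometrically. -/
lemma setIntegral_increment_le (β : ℝ) (f : E → ℝ) {τ : Ω → WithTop ℝ≥0}
    (hτ : IsStoppingTime M.filtration τ)
    (h : ∀ ω (t : ℝ≥0), (t : WithTop ℝ≥0) < τ ω → discountedGenerator Q β f (M.X t ω) ≤ 0)
    (m k : ℕ) (x : E) :
    ∫ ω in {ω | ((k * mesh m : ℝ≥0) : WithTop ℝ≥0) < τ ω},
      (M.discountedAt β f ((k + 1 : ℕ) * mesh m) ω -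
        M.discountedAt β f (k * mesh m) ω) ∂(M.P x) ≤
      Real.exp (-β * (1 / ((m : ℝ) + 1))) ^ k * (1 / ((m : ℝ) + 1) * M.slopeError β f m) := by
  set A := {ω | ((k * mesh m : ℝ≥0) : WithTop ℝ≥0) < τ ω} with hA
  set r := Real.exp (-β * (1 / ((m : ℝ) + 1))) with hr
  have hAm : MeasurableSet[M.filtration (k * mesh m)] A := hτ.measurableSet_gt _
  have hAm' : MeasurableSet A := M.filtration.le _ _ hAm
  have hrk : ∀ j : ℕ, Real.exp (-β * ((j * mesh m : ℝ≥0) : ℝ)) = r ^ j := fun j => by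
    rw [hr, ← Real.exp_nat_mul, mesh]; push_cast; ring_nf
  have hint : ∀ (g : E → ℝ) (t : ℝ≥0), Integrable (fun ω => g (M.X t ω)) ((M.P x).restrict A) :=
    fun g t => .of_bound ((measurable_of_finite g).comp (M.measurable_X t)).aestronglyMeasurable _
      (.of_forall fun ω => abs_le_sum_abs g _)
  have e1 : ∫ ω in A, (M.discountedAt β f ((k + 1 : ℕ) * mesh m) ω -
        M.discountedAt β f (k * mesh m) ω) ∂(M.P x) =
      r ^ k * ∫ ω in A, (r * M.transition (mesh m) f (M.X (k * mesh m) ω) -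
        f (M.X (k * mesh m) ω)) ∂(M.P x) := by
    simp only [discountedAt, hrk]
    rw [integral_sub ((hint _ _).const_mul _) ((hint _ _).const_mul _),
      integral_sub ((hint _ _).const_mul _) (hint _ _), integral_const_mul, integral_const_mul,
      integral_const_mul, ← M.setIntegral_transition x _ _ f hAm]
    have : ((k + 1 : ℕ) : ℝ≥0) * mesh m = k * mesh m + mesh m := by push_cast; ring
    rw [this]
    ring
  rw [e1]
  have he : 0 ≤ 1 / ((m : ℝ) + 1) * M.slopeError β f m :=
    mul_nonneg (by positivity) (Finset.sum_nonneg fun _ _ => abs_nonneg _)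
  gcongr
  calc _ ≤ ∫ ω in A, (1 / ((m : ℝ) + 1) * M.slopeError β f m) ∂(M.P x) := by
        refine setIntegral_mono_on (((hint _ _).const_mul _).sub (hint _ _))
          (integrable_const _) hAm' fun ω hω => ?_
        exact M.transition_step_le β f m (h ω _ hω)
    _ ≤ _ := by
        rw [setIntegral_const, smul_eq_mul]
        exact mul_le_of_le_one_left he measureReal_le_one

lemma integral_gridStopped_le {β : ℝ} (hβ : 0 < β) (f : E → ℝ) {τ : Ω → WithTop ℝ≥0}
    (hτ : IsStoppingTime M.filtration τ)
    (h : ∀ ω (t : ℝ≥0), (t : WithTop ℝ≥0) < τ ω → discountedGenerator Q β f (M.X t ω) ≤ 0)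
    (m : ℕ) (x : E) :
    ∫ ω, M.gridStopped β f τ m ω ∂(M.P x) ≤ f x + (1 + β) / β * M.slopeError β f m := by
  have h0 : ∫ ω, M.discountedAt β f 0 ω ∂(M.P x) = f x := by
    rw [integral_congr_ae (g := fun _ => f x)]
    · simp
    · filter_upwards [M.ae_start x] with ω hω
      simp [discountedAt, hω]
  have hi : ∀ k : ℕ, Integrable ({ω | ((k * mesh m : ℝ≥0) : WithTop ℝ≥0) < τ ω}.indicator
      (fun ω => M.discountedAt β f ((k + 1 : ℕ) * mesh m) ω -
        M.discountedAt β f (k * mesh m) ω)) (M.P x) := fun k =>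
    ((M.integrable_discountedAt hβ f _ x).sub
      (M.integrable_discountedAt hβ f _ x)).indicator (M.measurableSet_coe_lt hτ _)
  set r := Real.exp (-β * (1 / ((m : ℝ) + 1))) with hr
  have he : 0 ≤ M.slopeError β f m := Finset.sum_nonneg fun _ _ => abs_nonneg _
  simp only [gridStopped]
  rw [integral_add (M.integrable_discountedAt hβ f 0 x) (integrable_finsetSum _ fun k _ => hi k),
    h0, integral_finsetSum _ fun k _ => hi k]
  gcongr
  calc _ ≤ ∑ k ∈ Finset.range ((m + 1) * (m + 1)),
          r ^ k * (1 / ((m : ℝ) + 1) * M.slopeError β f m) := by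
        refine Finset.sum_le_sum fun k _ => ?_
        rw [integral_indicator (M.measurableSet_coe_lt hτ _)]
        exact M.setIntegral_increment_le β f hτ h m k x
    _ = ((∑ k ∈ Finset.range ((m + 1) * (m + 1)), r ^ k) * (1 / ((m : ℝ) + 1))) *
          M.slopeError β f m := by rw [← Finset.sum_mul, mul_assoc]
    _ ≤ _ := by
        gcongr
        set G := ∑ k ∈ Finset.range ((m + 1) * (m + 1)), r ^ k
        set d := 1 / ((m : ℝ) + 1) with hd
        have hd0 : 0 < d := by positivity
        have hd1 : d ≤ 1 := by
          rw [hd, div_le_one (by positivity)]; linarith [(Nat.cast_nonneg m : (0 : ℝ) ≤ m)]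
        have hG0 : 0 ≤ G := Finset.sum_nonneg fun _ _ => by positivity
        have hr0 : 0 < r := Real.exp_pos _
        have hG : G * (1 - r) ≤ 1 := by
          rw [geom_sum_mul_neg]
          linarith [pow_pos hr0 ((m + 1) * (m + 1))]
        have hr1 : r * (1 + β * d) ≤ 1 := by
          have h1 : 1 + β * d ≤ Real.exp (β * d) := by linarith [Real.add_one_le_exp (β * d)]
          calc r * (1 + β * d) ≤ r * Real.exp (β * d) := by gcongr
            _ = 1 := by rw [hr, ← Real.exp_add]; simp
        rw [le_div_iff₀ hβ]
        -- From r(1 + βd) ≤ 1 and d ≤ 1; together with G(1 - r) ≤ 1 it yields the constant (1 +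
        -- β)/β.
        have h2 : β * d ≤ (1 - r) * (1 + β) := by
          have h3 : β * d ≤ β := mul_le_of_le_one_right hβ.le hd1
          have h4 : r ≤ 1 := by nlinarith [mul_pos hr0 (mul_pos hβ hd0)]
          nlinarith [mul_nonneg (sub_nonneg.2 h4) (sub_nonneg.2 h3)]
        calc G * d * β = G * (β * d) := by ring
          _ ≤ G * ((1 - r) * (1 + β)) := by gcongr
          _ = (G * (1 - r)) * (1 + β) := by ring
          _ ≤ 1 * (1 + β) := by gcongr
          _ = _ := one_mul _

/-- Optional stopping: if `L f ≤ 0` along the path strictly before `τ`, then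
`E_x[exp (-β τ) f(X_τ)] ≤ f x`. -/
lemma integral_discounted_le {β : ℝ} (hβ : 0 < β) (f : E → ℝ) {τ : Ω → WithTop ℝ≥0}
    (hτ : IsStoppingTime M.filtration τ)
    (h : ∀ ω (t : ℝ≥0), (t : WithTop ℝ≥0) < τ ω → discountedGenerator Q β f (M.X t ω) ≤ 0)
    (x : E) : ∫ ω, M.discounted β f τ ω ∂(M.P x) ≤ f x := by
  have h1 : Tendsto (fun m => ∫ ω, M.gridStopped β f τ m ω ∂(M.P x)) atTop
      (𝓝 (∫ ω, M.discounted β f τ ω ∂(M.P x))) :=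
    tendsto_integral_of_dominated_convergence (fun _ => ∑ y, |f y|)
      (fun m => (M.measurable_gridStopped β f hτ m).aestronglyMeasurable) (integrable_const _)
      (fun m => .of_forall fun ω => M.abs_gridStopped_le hβ f τ m ω)
      (.of_forall fun ω => M.tendsto_gridStopped hβ f τ ω)
  have h2 : Tendsto (fun m => f x + (1 + β) / β * M.slopeError β f m) atTop (𝓝 (f x)) := by
    simpa using ((M.tendsto_slopeError β f).const_mul ((1 + β) / β)).const_add (f x)
  exact le_of_tendsto_of_tendsto' h1 h2 fun m => M.integral_gridStopped_le hβ f hτ h m x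

/-! ### Hitting times -/

lemma hit_le_of_mem {A : Set E} {t : ℝ≥0} {ω : Ω} (h : M.X t ω ∈ A) : M.hit A ω ≤ t :=
  hittingAfter_le_of_mem zero_le h

lemma notMem_of_lt_hit {A : Set E} {t : ℝ≥0} {ω : Ω} (h : (t : WithTop ℝ≥0) < M.hit A ω) :
    M.X t ω ∉ A := fun h' => (M.hit_le_of_mem h').not_gt h

lemma mem_of_hit_eq {A : Set E} {t : ℝ≥0} {ω : Ω} (h : M.hit A ω = t) : M.X t ω ∈ A := by
  classical
  by_contra hA
  have hex : ∃ j, 0 ≤ j ∧ M.X j ω ∈ A := by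
    by_contra hne
    rw [hit, hittingAfter, if_neg hne] at h
    exact WithTop.top_ne_coe h
  rw [hit, hittingAfter, if_pos hex, WithTop.coe_inj] at h
  -- If X_t were outside A, the path would avoid A on some [t, u), against t being the infimum.
  have hev := (M.right_continuous ω t).mono fun s hs => (by rwa [hs] : M.X s ω ∉ A)
  rw [eventually_nhdsWithin_iff] at hev
  obtain ⟨u, hu, hu'⟩ := exists_Ico_subset_of_mem_nhds hev ⟨t + 1, by simp⟩
  obtain ⟨j, hj, hj'⟩ := exists_lt_of_csInf_lt hex (h.trans_lt hu)
  have htj : t ≤ j := h ▸ csInf_le (OrderBot.bddBelow _) hj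
  exact hu' ⟨htj, hj'⟩ htj hj.2

lemma hit_le_iff {A : Set E} {t : ℝ≥0} {ω : Ω} :
    M.hit A ω ≤ t ↔ ∃ s ≤ t, M.X s ω ∈ A := by
  refine ⟨fun h => ?_, fun ⟨s, hs, hA⟩ => (M.hit_le_of_mem hA).trans (WithTop.coe_le_coe.2 hs)⟩
  lift M.hit A ω to ℝ≥0 using (h.trans_lt (WithTop.coe_lt_top t)).ne with s hs
  exact ⟨s, WithTop.coe_le_coe.1 h, M.mem_of_hit_eq hs.symm⟩

lemma hit_union (A B : Set E) (ω : Ω) : M.hit (A ∪ B) ω = min (M.hit A ω) (M.hit B ω) := by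
  refine WithTop.eq_of_forall_le_coe_iff fun t => ?_
  simp only [min_le_iff, hit_le_iff, Set.mem_union]
  constructor
  · rintro ⟨s, hs, h | h⟩
    exacts [.inl ⟨s, hs, h⟩, .inr ⟨s, hs, h⟩]
  · rintro (⟨s, hs, h⟩ | ⟨s, hs, h⟩)
    exacts [⟨s, hs, .inl h⟩, ⟨s, hs, .inr h⟩]

lemma hit_empty (ω : Ω) : M.hit ∅ ω = ⊤ := by
  rw [hit, hittingAfter_empty]

lemma measurable_X_filtration {s t : ℝ≥0} (h : s ≤ t) : Measurable[M.filtration t] (M.X s) :=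
  (comap_measurable (M.X s)).mono
    (le_iSup₂ (f := fun s (_ : s ≤ t) => MeasurableSpace.comap (M.X s) inferInstance) s h) le_rfl

/-- No completed filtration is needed: a path stays in its state for a while, so a visit to A before
t is seen at a time of a countable dense set before t. Time t itself must be tested separately. -/
lemma isStoppingTime_hit (A : Set E) : IsStoppingTime M.filtration (M.hit A) := by
  intro t
  obtain ⟨d, hdc, hd⟩ := TopologicalSpace.exists_countable_dense ℝ≥0
  have key : {ω | M.hit A ω ≤ t} =
      M.X t ⁻¹' A ∪ ⋃ q ∈ d, ⋃ (_ : q ≤ t), M.X q ⁻¹' A := by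
    ext ω
    simp only [Set.mem_ofPred_eq, hit_le_iff, Set.mem_union, Set.mem_iUnion, Set.mem_preimage]
    constructor
    · rintro ⟨s, hs, hA⟩
      rcases hs.eq_or_lt with rfl | hs
      · exact .inl hA
      have hev := M.right_continuous ω s
      rw [eventually_nhdsWithin_iff] at hev
      obtain ⟨u, hu, hu'⟩ := exists_Ico_subset_of_mem_nhds hev ⟨t, hs⟩
      obtain ⟨q, hq, hqd⟩ := hd.exists_between (lt_min hu hs)
      refine .inr ⟨q, hq, (hqd.2.trans_le (min_le_right _ _)).le, ?_⟩
      rwa [hu' ⟨hqd.1.le, hqd.2.trans_le (min_le_left _ _)⟩ hqd.1.le]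
    · rintro (hA | ⟨q, -, hq, hA⟩)
      exacts [⟨t, le_rfl, hA⟩, ⟨q, hq, hA⟩]
  have hA : MeasurableSet A := A.toFinite.measurableSet
  rw [key]
  refine .union (M.measurable_X_filtration le_rfl hA) (.biUnion hdc fun q _ => ?_)
  exact .iUnion fun hq => M.measurable_X_filtration hq hA

/-! ### Verification -/

lemma measurableSet_stopTime_le {τ γ : Ω → WithTop ℝ≥0} (hτ : IsStoppingTime M.filtration τ)
    (hγ : IsStoppingTime M.filtration γ) : MeasurableSet {ω | τ ω ≤ γ ω} :=
  hτ.measurableSpace_le _ (hτ.measurableSet_le_stopping_time hγ)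

open Classical in
lemma integrable_payoff_integrand {β : ℝ} (hβ : 0 < β) (ψ φ : E → ℝ) {τ γ : Ω → WithTop ℝ≥0}
    (hτ : IsStoppingTime M.filtration τ) (hγ : IsStoppingTime M.filtration γ) (x : E) :
    Integrable (fun ω => if τ ω ≤ γ ω then M.discounted β ψ τ ω else M.discounted β φ γ ω)
      (M.P x) := by
  refine .of_bound (C := max (∑ y, |ψ y|) (∑ y, |φ y|)) (Measurable.ite
    (M.measurableSet_stopTime_le hτ hγ) (M.measurable_discounted hβ ψ hτ)
    (M.measurable_discounted hβ φ hγ)).aestronglyMeasurable (.of_forall fun ω => ?_)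
  split_ifs
  · exact le_max_of_le_left (M.abs_discounted_le hβ ψ τ ω)
  · exact le_max_of_le_right (M.abs_discounted_le hβ φ γ ω)

lemma discounted_mono_of_forall (β : ℝ) {f g : E → ℝ} {τ σ : Ω → WithTop ℝ≥0} {ω : Ω}
    (hτσ : τ ω = σ ω) (h : ∀ t : ℝ≥0, τ ω = t → f (M.X t ω) ≤ g (M.X t ω)) :
    M.discounted β f τ ω ≤ M.discounted β g σ ω := by
  rw [discounted, discounted, hτσ]
  split_ifs with hσ
  · rfl
  · lift σ ω to ℝ≥0 using hσ with t
    exact mul_le_mul_of_nonneg_left (h t hτσ) (Real.exp_pos _).le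

/-- Verification: a function that is `β`-superharmonic before `τ ∧ γ` and dominates the payoff
there is an upper bound of the expected payoff. -/
lemma payoff_le {β : ℝ} (hβ : 0 < β) {ψ φ : E → ℝ} (f : E → ℝ) {τ γ : Ω → WithTop ℝ≥0}
    (hτ : IsStoppingTime M.filtration τ) (hγ : IsStoppingTime M.filtration γ)
    (h : ∀ ω (t : ℝ≥0), (t : WithTop ℝ≥0) < τ ω → (t : WithTop ℝ≥0) < γ ω →
      discountedGenerator Q β f (M.X t ω) ≤ 0)
    (hτf : ∀ ω (t : ℝ≥0), τ ω = t → τ ω ≤ γ ω → ψ (M.X t ω) ≤ f (M.X t ω))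
    (hγf : ∀ ω (t : ℝ≥0), γ ω = t → γ ω < τ ω → φ (M.X t ω) ≤ f (M.X t ω)) (x : E) :
    M.payoff β ψ φ τ γ x ≤ f x := by
  have hσ := hτ.min hγ
  refine le_trans (integral_mono (M.integrable_payoff_integrand hβ ψ φ hτ hγ x)
    (M.integrable_discounted hβ f hσ x) fun ω => ?_)
    (M.integral_discounted_le hβ f hσ (fun ω t ht => ?_) x)
  · dsimp only
    split_ifs with hle
    · exact M.discounted_mono_of_forall β (min_eq_left hle).symm fun t ht => hτf ω t ht hle
    · rw [not_le] at hle
      exact M.discounted_mono_of_forall β (min_eq_right hle.le).symm fun t ht => hγf ω t ht hle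
  · exact h ω t (ht.trans_le (min_le_left _ _)) (ht.trans_le (min_le_right _ _))

lemma discounted_neg (β : ℝ) (f : E → ℝ) (τ : Ω → WithTop ℝ≥0) (ω : Ω) :
    M.discounted β (-f) τ ω = -M.discounted β f τ ω := by
  simp only [discounted, Pi.neg_apply]
  split_ifs <;> simp

lemma payoff_neg (β : ℝ) (ψ φ : E → ℝ) (τ γ : Ω → WithTop ℝ≥0) (x : E) :
    M.payoff β (-ψ) (-φ) τ γ x = -M.payoff β ψ φ τ γ x := by
  rw [payoff, payoff, ← integral_neg]
  refine integral_congr_ae (.of_forall fun ω => ?_)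
  dsimp only
  split_ifs <;> exact M.discounted_neg ..

lemma discountedGenerator_neg (β : ℝ) (f : E → ℝ) (x : E) :
    discountedGenerator Q β (-f) x = -discountedGenerator Q β f x := by
  simp only [discountedGenerator, Matrix.mulVec_neg, Pi.neg_apply]
  ring

/-- Verification from below. -/
lemma le_payoff {β : ℝ} (hβ : 0 < β) {ψ φ : E → ℝ} (f : E → ℝ) {τ γ : Ω → WithTop ℝ≥0}
    (hτ : IsStoppingTime M.filtration τ) (hγ : IsStoppingTime M.filtration γ)
    (h : ∀ ω (t : ℝ≥0), (t : WithTop ℝ≥0) < τ ω → (t : WithTop ℝ≥0) < γ ω →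
      0 ≤ discountedGenerator Q β f (M.X t ω))
    (hτf : ∀ ω (t : ℝ≥0), τ ω = t → τ ω ≤ γ ω → f (M.X t ω) ≤ ψ (M.X t ω))
    (hγf : ∀ ω (t : ℝ≥0), γ ω = t → γ ω < τ ω → f (M.X t ω) ≤ φ (M.X t ω)) (x : E) :
    f x ≤ M.payoff β ψ φ τ γ x := by
  have := M.payoff_le hβ (ψ := -ψ) (φ := -φ) (-f) hτ hγ
    (fun ω t h1 h2 => by rw [discountedGenerator_neg]; linarith [h ω t h1 h2])
    (fun ω t h1 h2 => neg_le_neg (hτf ω t h1 h2)) (fun ω t h1 h2 => neg_le_neg (hγf ω t h1 h2)) x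
  rw [payoff_neg] at this
  exact neg_le_neg_iff.1 this

lemma abs_payoff_le {β : ℝ} (hβ : 0 < β) (ψ φ : E → ℝ) (τ γ : Ω → WithTop ℝ≥0) (x : E) :
    |M.payoff β ψ φ τ γ x| ≤ max (∑ y, |ψ y|) (∑ y, |φ y|) := by
  have := norm_integral_le_of_norm_le_const (μ := M.P x) (C := max (∑ y, |ψ y|) (∑ y, |φ y|))
    (f := fun ω => if τ ω ≤ γ ω then M.discounted β ψ τ ω else M.discounted β φ γ ω)
    (.of_forall fun ω => by
      split_ifs
      · exact le_max_of_le_left (M.abs_discounted_le hβ ψ τ ω)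
      · exact le_max_of_le_right (M.abs_discounted_le hβ φ γ ω))
  simpa [payoff] using this

/-! ### The Dirichlet problem -/

/-- The Dirichlet problem `L f = 0` off `B`, `f = g` on `B`, is solvable. -/
lemma exists_dirichlet (M : MarkovChain Ω Q) {β : ℝ} (hβ : 0 < β) (B : Set E) (g : E → ℝ) :
    ∃ f : E → ℝ, (∀ x ∈ B, f x = g x) ∧ ∀ x ∉ B, discountedGenerator Q β f x = 0 := by
  classical
  let T : (E → ℝ) →ₗ[ℝ] (E → ℝ) :=
    { toFun := fun f x => if x ∈ B then f x else discountedGenerator Q β f x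
      map_add' := fun f g => by
        ext x
        simp only [Pi.add_apply, discountedGenerator, Matrix.mulVec_add]
        split_ifs <;> ring
      map_smul' := fun c f => by
        ext x
        simp only [Pi.smul_apply, discountedGenerator, Matrix.mulVec_smul, smul_eq_mul,
          RingHom.id_apply]
        split_ifs <;> ring }
  have hT : ∀ f x, T f x = if x ∈ B then f x else discountedGenerator Q β f x := fun _ _ => rfl
  -- Maximum principle: verification with zero rewards gives f ≤ 0 on the kernel, and -f gives the
  -- converse. Injectivity then implies surjectivity in finite dimension.
  have hle : ∀ f, T f = 0 → ∀ x, f x ≤ 0 := fun f hf x => by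
    have h0 : ∀ x, (if x ∈ B then f x else discountedGenerator Q β f x) = 0 := fun x => by
      rw [← hT, hf]; rfl
    have h1 : M.payoff β 0 0 (M.hit B) (M.hit ∅) x = 0 := by simp [payoff, discounted]
    rw [← h1]
    refine M.le_payoff hβ f (M.isStoppingTime_hit B) (M.isStoppingTime_hit ∅)
      (fun ω t ht _ => ?_) (fun ω t ht _ => ?_) (fun ω t ht _ => ?_) x
    · have := h0 (M.X t ω)
      rw [if_neg (M.notMem_of_lt_hit ht)] at this
      exact this.ge
    · have := h0 (M.X t ω)
      rw [if_pos (M.mem_of_hit_eq ht)] at this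
      exact this.le
    · exact absurd (M.mem_of_hit_eq ht) (Set.notMem_empty _)
  have hinj : Function.Injective T := by
    rw [← LinearMap.ker_eq_bot, LinearMap.ker_eq_bot']
    intro f hf
    ext x
    have h1 := hle (-f) (by rw [map_neg, hf, neg_zero]) x
    exact le_antisymm (hle f hf x) (by simpa using h1)
  obtain ⟨f, hf⟩ := LinearMap.surjective_of_injective hinj fun x => if x ∈ B then g x else 0
  have hfx : ∀ x, (if x ∈ B then f x else discountedGenerator Q β f x) =
    if x ∈ B then g x else 0 := fun x => by rw [← hT, hf]
  exact ⟨f, fun x hx => by simpa [hx] using hfx x, fun x hx => by simpa [hx] using hfx x⟩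

/-- The payoff of two hitting times of disjoint sets solves the Dirichlet problem. -/
lemma payoff_hit_hit {β : ℝ} (hβ : 0 < β) (ψ φ : E → ℝ) {D S : Set E} (hDS : D ⊆ Sᶜ) :
    (∀ x ∈ D, M.payoff β ψ φ (M.hit D) (M.hit S) x = ψ x) ∧
    (∀ x ∈ S, M.payoff β ψ φ (M.hit D) (M.hit S) x = φ x) ∧
    ∀ x ∉ D, x ∉ S →
      discountedGenerator Q β (M.payoff β ψ φ (M.hit D) (M.hit S)) x = 0 := by
  classical
  obtain ⟨f, hfB, hf⟩ := M.exists_dirichlet hβ (D ∪ S) (fun x => if x ∈ D then ψ x else φ x)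
  have hfD : ∀ x ∈ D, f x = ψ x := fun x hx => by rw [hfB x (.inl hx), if_pos hx]
  have hfS : ∀ x ∈ S, f x = φ x := fun x hx => by
    rw [hfB x (.inr hx), if_neg fun h => hDS h hx]
  have hL : ∀ ω (t : ℝ≥0), (t : WithTop ℝ≥0) < M.hit D ω → (t : WithTop ℝ≥0) < M.hit S ω →
      discountedGenerator Q β f (M.X t ω) = 0 := fun ω t h1 h2 =>
    hf _ fun h => h.elim (M.notMem_of_lt_hit h1) (M.notMem_of_lt_hit h2)
  have heq : M.payoff β ψ φ (M.hit D) (M.hit S) = f := by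
    ext x
    refine le_antisymm ?_ ?_
    · exact M.payoff_le hβ f (M.isStoppingTime_hit D) (M.isStoppingTime_hit S)
        (fun ω t h1 h2 => (hL ω t h1 h2).le) (fun ω t h _ => (hfD _ (M.mem_of_hit_eq h)).ge)
        (fun ω t h _ => (hfS _ (M.mem_of_hit_eq h)).ge) x
    · exact M.le_payoff hβ f (M.isStoppingTime_hit D) (M.isStoppingTime_hit S)
        (fun ω t h1 h2 => (hL ω t h1 h2).ge) (fun ω t h _ => (hfD _ (M.mem_of_hit_eq h)).le)
        (fun ω t h _ => (hfS _ (M.mem_of_hit_eq h)).le) x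
  rw [heq]
  exact ⟨hfD, hfS, fun x h1 h2 => hf x fun h => h.elim h1 h2⟩

/-! ### Best responses -/

lemma bddAbove_payoff {β : ℝ} (hβ : 0 < β) (ψ φ : E → ℝ) (γ : Ω → WithTop ℝ≥0) (x : E) :
    BddAbove (Set.range fun τ : M.StopTime => M.payoff β ψ φ τ.1 γ x) :=
  ⟨_, Set.forall_mem_range.2 fun τ => (abs_le.1 (M.abs_payoff_le hβ ψ φ τ.1 γ x)).2⟩

lemma bddBelow_payoff {β : ℝ} (hβ : 0 < β) (ψ φ : E → ℝ) (τ : Ω → WithTop ℝ≥0) (x : E) :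
    BddBelow (Set.range fun γ : M.StopTime => M.payoff β ψ φ τ γ.1 x) :=
  ⟨_, Set.forall_mem_range.2 fun γ => (abs_le.1 (M.abs_payoff_le hβ ψ φ τ γ.1 x)).1⟩

instance : Nonempty M.StopTime := ⟨⟨_, isStoppingTime_const M.filtration 0⟩⟩

lemma payoff_le_bestResponse {β : ℝ} (hβ : 0 < β) (ψ φ : E → ℝ) (S : Set E)
    {τ : Ω → WithTop ℝ≥0} (hτ : IsStoppingTime M.filtration τ) (x : E) :
    M.payoff β ψ φ τ (M.hit S) x ≤ M.bestResponse β ψ φ S x :=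
  le_ciSup (M.bddAbove_payoff hβ ψ φ (M.hit S) x) (⟨τ, hτ⟩ : M.StopTime)

/-- Verification for the maximizer's problem against `h(S)`. -/
lemma bestResponse_le {β : ℝ} (hβ : 0 < β) {ψ φ : E → ℝ} {S : Set E} {f : E → ℝ}
    (hψ : ∀ x, ψ x ≤ f x) (hφ : ∀ x ∈ S, φ x ≤ f x)
    (hL : ∀ x ∉ S, discountedGenerator Q β f x ≤ 0) (x : E) :
    M.bestResponse β ψ φ S x ≤ f x :=
  ciSup_le fun τ => M.payoff_le hβ f τ.2 (M.isStoppingTime_hit S)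
    (fun _ _ _ h => hL _ (M.notMem_of_lt_hit h)) (fun _ _ _ _ => hψ _)
    (fun _ _ h _ => hφ _ (M.mem_of_hit_eq h)) x

/-- Since the dummy set at index 0 is empty, results on V_k and D_k at k = 0 cover the one-player
problem. -/
lemma onePlayerValue_eq (β : ℝ) (ψ φ : E → ℝ) (x : E) :
    M.onePlayerValue β ψ x = M.V β ψ φ 0 x := by
  simp only [onePlayerValue, V, bestResponse, payoff, S, hit_empty, le_top, if_true]

/-- Off-diagonal rates are nonnegative, so raising f away from x can only raise L f at x. -/
lemma discountedGenerator_mono_of_eq (M : MarkovChain Ω Q) (β : ℝ) {f g : E → ℝ} {x : E}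
    (h : ∀ y, f y ≤ g y) (hx : f x = g x) :
    discountedGenerator Q β f x ≤ discountedGenerator Q β g x := by
  rw [discountedGenerator, discountedGenerator, hx]
  refine sub_le_sub_right (Finset.sum_le_sum fun y _ => ?_) _
  by_cases hxy : x = y
  · rw [← hxy, hx]
  · exact mul_le_mul_of_nonneg_left (h y) (M.offDiag_nonneg x y hxy)

/-! ### Inner policy iteration -/

lemma innerD_succ_subset (β : ℝ) (ψ φ : E → ℝ) (k n : ℕ) :
    M.innerD β ψ φ k (n + 1) ⊆ M.innerD β ψ φ k n := Set.inter_subset_right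

lemma innerD_subset_compl (β : ℝ) (ψ φ : E → ℝ) (k n : ℕ) :
    M.innerD β ψ φ k n ⊆ (M.S β ψ φ k)ᶜ := by
  induction n with
  | zero => exact Set.inter_subset_right
  | succ n ih => exact (M.innerD_succ_subset β ψ φ k n).trans ih

/-- The payoff of the `n`-th policy of the inner iteration against `h(S_k)`. -/
noncomputable def innerV (β : ℝ) (ψ φ : E → ℝ) (k n : ℕ) : E → ℝ :=
  M.payoff β ψ φ (M.hit (M.innerD β ψ φ k n)) (M.hit (M.S β ψ φ k))

section

variable {β : ℝ} (hβ : 0 < β) {ψ φ : E → ℝ}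
include hβ

lemma innerV_of_mem_innerD {k n : ℕ} {x : E} (hx : x ∈ M.innerD β ψ φ k n) :
    M.innerV β ψ φ k n x = ψ x :=
  (M.payoff_hit_hit hβ ψ φ (M.innerD_subset_compl β ψ φ k n)).1 x hx

lemma innerV_of_mem_S {k n : ℕ} {x : E} (hx : x ∈ M.S β ψ φ k) : M.innerV β ψ φ k n x = φ x :=
  (M.payoff_hit_hit hβ ψ φ (M.innerD_subset_compl β ψ φ k n)).2.1 x hx

lemma discountedGenerator_innerV {k n : ℕ} {x : E} (hx : x ∉ M.innerD β ψ φ k n)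
    (hx' : x ∉ M.S β ψ φ k) : discountedGenerator Q β (M.innerV β ψ φ k n) x = 0 :=
  (M.payoff_hit_hit hβ ψ φ (M.innerD_subset_compl β ψ φ k n)).2.2 x hx hx'

lemma le_innerV_of_le {k n : ℕ} {f : E → ℝ} (hψ : ∀ x ∈ M.innerD β ψ φ k n, f x ≤ ψ x)
    (hφ : ∀ x ∈ M.S β ψ φ k, f x ≤ φ x)
    (hL : ∀ x ∉ M.innerD β ψ φ k n, x ∉ M.S β ψ φ k → 0 ≤ discountedGenerator Q β f x) (x : E) :
    f x ≤ M.innerV β ψ φ k n x :=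
  M.le_payoff hβ f (M.isStoppingTime_hit _) (M.isStoppingTime_hit _)
    (fun _ _ h1 h2 => hL _ (M.notMem_of_lt_hit h1) (M.notMem_of_lt_hit h2))
    (fun _ _ h _ => hψ _ (M.mem_of_hit_eq h)) (fun _ _ h _ => hφ _ (M.mem_of_hit_eq h)) x

/-- Policy improvement: the states removed from the stopping set have L f > 0 for the old payoff f,
so continuing there pays. -/
lemma innerV_le_succ (k n : ℕ) (x : E) : M.innerV β ψ φ k n x ≤ M.innerV β ψ φ k (n + 1) x := by
  refine M.le_innerV_of_le hβ (fun y hy => ?_) (fun y hy => (M.innerV_of_mem_S hβ hy).le)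
    (fun y hy hy' => ?_) x
  · exact (M.innerV_of_mem_innerD hβ (M.innerD_succ_subset β ψ φ k n hy)).le
  · by_cases hn : y ∈ M.innerD β ψ φ k n
    · by_contra hneg
      exact hy ⟨(not_le.1 hneg).le, hn⟩
    · exact (M.discountedGenerator_innerV hβ hn hy').ge

lemma le_innerV (hψφ : ∀ x, ψ x ≤ φ x) (k n : ℕ) (x : E) : ψ x ≤ M.innerV β ψ φ k n x := by
  induction n with
  | zero =>
    refine M.le_innerV_of_le hβ (fun _ _ => le_rfl) (fun y _ => hψφ y) (fun y hy hy' => ?_) x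
    by_contra hneg
    exact hy ⟨(not_le.1 hneg).le, hy'⟩
  | succ n ih => exact ih.trans (M.innerV_le_succ hβ k n x)

omit hβ in
lemma exists_D_eq (β : ℝ) (ψ φ : E → ℝ) (k : ℕ) :
    ∃ n, M.D β ψ φ k = M.innerD β ψ φ k n ∧ M.innerD β ψ φ k (n + 1) = M.innerD β ψ φ k n := by
  have hanti : Antitone (M.innerD β ψ φ k) := antitone_nat_of_succ_le (M.innerD_succ_subset β ψ φ k)
  obtain ⟨n, hn⟩ := WellFoundedGT.monotone_chain_condition
    (⟨fun n => OrderDual.toDual (M.innerD β ψ φ k n), hanti⟩ : ℕ →o (Set E)ᵒᵈ)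
  have hn' : ∀ m ≥ n, M.innerD β ψ φ k n = M.innerD β ψ φ k m := hn
  refine ⟨n, Set.Subset.antisymm (Set.iInter_subset _ n) (Set.subset_iInter fun m => ?_),
    (hn' _ n.le_succ).symm⟩
  rcases le_total n m with h | h
  · exact (hn' m h).subset
  · exact hanti h

/-- When the inner sets stabilise, every remaining stopping state has passed the test L f ≤ 0, and L
f = 0 elsewhere off S_k. Verification then makes this policy optimal. -/
lemma exists_V_eq_innerV (hψφ : ∀ x, ψ x ≤ φ x) (k : ℕ) :
    ∃ n, M.D β ψ φ k = M.innerD β ψ φ k n ∧ M.V β ψ φ k = M.innerV β ψ φ k n ∧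
      ∀ x ∉ M.S β ψ φ k, discountedGenerator Q β (M.V β ψ φ k) x ≤ 0 := by
  obtain ⟨n, hD, hn⟩ := M.exists_D_eq β ψ φ k
  have hL : ∀ x ∉ M.S β ψ φ k, discountedGenerator Q β (M.innerV β ψ φ k n) x ≤ 0 := by
    intro x hx
    by_cases hxD : x ∈ M.innerD β ψ φ k n
    · rw [← hn] at hxD
      exact hxD.1
    · exact (M.discountedGenerator_innerV hβ hxD hx).le
  have hV : M.V β ψ φ k = M.innerV β ψ φ k n := funext fun x => le_antisymm
    (M.bestResponse_le hβ (M.le_innerV hβ hψφ k n) (fun y hy => (M.innerV_of_mem_S hβ hy).ge) hL x)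
    (M.payoff_le_bestResponse hβ ψ φ _ (M.isStoppingTime_hit _) x)
  exact ⟨n, hD, hV, hV ▸ hL⟩

lemma V_eq_payoff (hψφ : ∀ x, ψ x ≤ φ x) (k : ℕ) :
    M.V β ψ φ k = M.payoff β ψ φ (M.hit (M.D β ψ φ k)) (M.hit (M.S β ψ φ k)) := by
  obtain ⟨n, hD, hV, -⟩ := M.exists_V_eq_innerV hβ hψφ k
  rw [hV, hD, innerV]

lemma V_of_mem_S (hψφ : ∀ x, ψ x ≤ φ x) {k : ℕ} {x : E} (hx : x ∈ M.S β ψ φ k) :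
    M.V β ψ φ k x = φ x := by
  obtain ⟨n, -, hV, -⟩ := M.exists_V_eq_innerV hβ hψφ k
  rw [hV, M.innerV_of_mem_S hβ hx]

lemma le_V (hψφ : ∀ x, ψ x ≤ φ x) (k : ℕ) (x : E) : ψ x ≤ M.V β ψ φ k x := by
  obtain ⟨n, -, hV, -⟩ := M.exists_V_eq_innerV hβ hψφ k
  rw [hV]
  exact M.le_innerV hβ hψφ k n x

lemma discountedGenerator_V_nonpos (hψφ : ∀ x, ψ x ≤ φ x) {k : ℕ} {x : E}
    (hx : x ∉ M.S β ψ φ k) : discountedGenerator Q β (M.V β ψ φ k) x ≤ 0 := by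
  obtain ⟨n, -, -, h⟩ := M.exists_V_eq_innerV hβ hψφ k
  exact h x hx

lemma discountedGenerator_V_eq_zero (hψφ : ∀ x, ψ x ≤ φ x) {k : ℕ} {x : E}
    (hx : x ∉ M.S β ψ φ k) (hxD : x ∉ M.D β ψ φ k) :
    discountedGenerator Q β (M.V β ψ φ k) x = 0 := by
  obtain ⟨n, hD, hV, -⟩ := M.exists_V_eq_innerV hβ hψφ k
  rw [hD] at hxD
  rw [hV, M.discountedGenerator_innerV hβ hxD hx]

/-- `D_k` is the contact set of `V_k` with `ψ` outside `S_k`. -/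
lemma mem_D_iff (hψφ : ∀ x, ψ x ≤ φ x) {k : ℕ} {x : E} :
    x ∈ M.D β ψ φ k ↔ x ∉ M.S β ψ φ k ∧ M.V β ψ φ k x = ψ x := by
  constructor
  · intro hx
    obtain ⟨n, hD, hV, -⟩ := M.exists_V_eq_innerV hβ hψφ k
    rw [hD] at hx
    exact ⟨M.innerD_subset_compl β ψ φ k n hx, by rw [hV, M.innerV_of_mem_innerD hβ hx]⟩
  -- At x both ψ and every inner payoff that still stops at x touch V_k from below, so L of them is
  -- at most L V_k ≤ 0 and x is never removed.
  · rintro ⟨hxS, hx⟩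
    have hL := M.discountedGenerator_V_nonpos hβ hψφ hxS
    refine Set.mem_iInter.2 fun n => ?_
    induction n with
    | zero =>
      exact ⟨(M.discountedGenerator_mono_of_eq β (M.le_V hβ hψφ k) hx.symm).trans hL, hxS⟩
    | succ n ih =>
      refine ⟨(M.discountedGenerator_mono_of_eq β (fun y => ?_) ?_).trans hL, ih⟩
      · exact M.payoff_le_bestResponse hβ ψ φ _ (M.isStoppingTime_hit _) y
      · exact (M.innerV_of_mem_innerD hβ ih).trans hx.symm

end

/-! ### Outer iteration -/

lemma contact_subset_S (β : ℝ) (ψ φ : E → ℝ) (k : ℕ) :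
    {x | φ x = ψ x} ⊆ M.S β ψ φ (k + 1) := by
  cases k <;> exact Set.subset_union_right

lemma mem_S_add_two (β : ℝ) (ψ φ : E → ℝ) (k : ℕ) (x : E) :
    x ∈ M.S β ψ φ (k + 2) ↔
      (x ∈ M.S β ψ φ (k + 1) ∧ 0 ≤ discountedGenerator Q β (M.V β ψ φ (k + 1)) x) ∨
        φ x = ψ x := Iff.rfl

lemma S_succ_subset (β : ℝ) (ψ φ : E → ℝ) (k : ℕ) :
    M.S β ψ φ (k + 2) ⊆ M.S β ψ φ (k + 1) := by
  rintro x (hx | hx)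
  exacts [hx.1, M.contact_subset_S β ψ φ k hx]

lemma S_antitone (β : ℝ) (ψ φ : E → ℝ) : Antitone fun k => M.S β ψ φ (k + 1) :=
  antitone_nat_of_succ_le (M.S_succ_subset β ψ φ)

/-- Each set is a function of its predecessor alone, so one repetition freezes the sequence. -/
lemma S_eq_of_le (β : ℝ) (ψ φ : E → ℝ) {n : ℕ} (h : M.S β ψ φ (n + 2) = M.S β ψ φ (n + 1)) {k : ℕ}
    (hk : n ≤ k) : M.S β ψ φ (k + 1) = M.S β ψ φ (n + 1) := by
  have hstep : ∀ i, M.S β ψ φ (n + i + 2) = M.S β ψ φ (n + i + 1) := fun i => by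
    induction i with
    | zero => exact h
    | succ i ih =>
      change M.S β ψ φ ((n + i + 1) + 2) = M.S β ψ φ (n + i + 2)
      ext x
      rw [mem_S_add_two, mem_S_add_two, V, V, ih]
      tauto
  induction k, hk using Nat.le_induction with
  | base => rfl
  | succ k hk ih =>
    obtain ⟨i, rfl⟩ := Nat.exists_eq_add_of_le hk
    rw [← ih]
    exact hstep i

lemma le_ncard_S_diff (β : ℝ) (ψ φ : E → ℝ) (n : ℕ)
    (h : ∀ i < n, M.S β ψ φ (i + 2) ≠ M.S β ψ φ (i + 1)) :
    n ≤ (M.S β ψ φ 1 \ M.S β ψ φ (n + 1)).ncard := by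
  induction n with
  | zero => exact Nat.zero_le _
  | succ n ih =>
    refine (ih fun i hi => h i (hi.trans n.lt_succ_self)).trans_lt (Set.ncard_lt_ncard ?_)
    have hlt : M.S β ψ φ (n + 2) ⊂ M.S β ψ φ (n + 1) :=
      (M.S_succ_subset β ψ φ n).ssubset_of_ne (h n n.lt_succ_self)
    obtain ⟨y, hy, hy'⟩ := Set.exists_of_ssubset hlt
    refine Set.ssubset_iff_exists.2 ⟨Set.sdiff_subset_sdiff_right hlt.subset, y,
      ⟨M.S_antitone β ψ φ n.zero_le hy, hy'⟩, fun h => h.2 hy⟩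

section

variable {β : ℝ} (hβ : 0 < β) {ψ φ : E → ℝ} (hψφ : ∀ x, ψ x ≤ φ x)
include hβ hψφ

/-- V_0 is superharmonic everywhere, and S_1 lies inside {V_0 ≥ φ}, so V_0 is a supersolution
against h(S_1). -/
lemma V_one_le (x : E) : M.V β ψ φ 1 x ≤ M.V β ψ φ 0 x := by
  refine M.bestResponse_le hβ (M.le_V hβ hψφ 0) (fun y hy => ?_)
    (fun y _ => M.discountedGenerator_V_nonpos hβ hψφ (Set.notMem_empty y)) x
  rcases hy with hy | hy
  · rw [Set.mem_ofPred_eq, M.onePlayerValue_eq β ψ φ] at hy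
    exact hy.le
  · exact (show φ y = ψ y from hy).trans_le (M.le_V hβ hψφ 0 y)

lemma V_succ_le (k : ℕ) (x : E) : M.V β ψ φ (k + 2) x ≤ M.V β ψ φ (k + 1) x := by
  refine M.bestResponse_le hβ (M.le_V hβ hψφ _)
    (fun y hy => (M.V_of_mem_S hβ hψφ (M.S_succ_subset β ψ φ k hy)).ge) (fun y hy => ?_) x
  by_cases hy' : y ∈ M.S β ψ φ (k + 1)
  · by_contra hneg
    exact hy (.inl ⟨hy', (not_le.1 hneg).le⟩)
  · exact M.discountedGenerator_V_nonpos hβ hψφ hy'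

lemma V_le (k : ℕ) (x : E) : M.V β ψ φ (k + 1) x ≤ φ x := by
  induction k with
  | zero =>
    by_cases hx : x ∈ M.S β ψ φ 1
    · exact (M.V_of_mem_S hβ hψφ hx).le
    · refine (M.V_one_le hβ hψφ x).trans ?_
      rw [← M.onePlayerValue_eq β ψ φ]
      exact not_lt.1 fun h => hx (.inl h)
  | succ k ih => exact (M.V_succ_le hβ hψφ k x).trans ih

/-- Where V_k already equals its lower bound ψ, a smaller V_{k+1} ≥ ψ must agree with it. -/
lemma D_succ_subset (k : ℕ) : M.D β ψ φ (k + 1) ⊆ M.D β ψ φ (k + 2) := fun x hx => by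
  rw [M.mem_D_iff hβ hψφ] at hx ⊢
  exact ⟨fun h => hx.1 (M.S_succ_subset β ψ φ k h), le_antisymm
    ((M.V_succ_le hβ hψφ k x).trans hx.2.le) (M.le_V hβ hψφ _ x)⟩

/-- If the iteration of the sets `S_k` ever moves, at least two states are never removed. -/
lemma ncard_S_diff_add_two_le (hψ : ∀ x, 0 ≤ ψ x) {k : ℕ}
    (hk : M.S β ψ φ (k + 1) ≠ M.S β ψ φ 1) :
    (M.S β ψ φ 1 \ M.S β ψ φ (k + 1)).ncard + 2 ≤ Fintype.card E := by
  have hS0 : M.S β ψ φ 0 = ∅ := rfl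
  -- If S_{k+1} were inside D_0, the one-player optimum h(D_0) would never come after h(S_{k+1}), so
  -- V_0 ≤ V_{k+1} ≤ φ. Then S_1 = {φ = ψ} and nothing could leave.
  obtain ⟨y, hyS, hyD⟩ : ∃ y ∈ M.S β ψ φ (k + 1), y ∉ M.D β ψ φ 0 := by
    by_contra! hsub
    refine hk (Set.Subset.antisymm (M.S_antitone β ψ φ k.zero_le) ?_)
    have h0 : ∀ x, M.V β ψ φ 0 x ≤ φ x := fun x => by
      refine le_trans ?_ (M.V_le hβ hψφ k x)
      refine le_trans (le_of_eq ?_)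
        (M.payoff_le_bestResponse hβ ψ φ _ (M.isStoppingTime_hit (M.D β ψ φ 0)) x)
      have hle : ∀ ω, M.hit (M.D β ψ φ 0) ω ≤ M.hit (M.S β ψ φ (k + 1)) ω := fun ω =>
        hittingAfter_apply_anti M.X 0 ω hsub
      simp only [M.V_eq_payoff hβ hψφ 0, payoff, hle, if_true, hS0, hit_empty, le_top]
    rintro x (hx | hx)
    · rw [Set.mem_ofPred_eq, M.onePlayerValue_eq β ψ φ] at hx
      exact absurd (h0 x) (not_le.2 hx)
    · exact M.contact_subset_S β ψ φ k hx
  -- If D_0 were empty, never stopping would be optimal and V_0 = 0; with ψ ≥ 0 this forces V_0 = ψ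
  -- at y, putting y in D_0.
  obtain ⟨z, hz⟩ : (M.D β ψ φ 0).Nonempty := by
    by_contra hne
    rw [Set.not_nonempty_iff_eq_empty] at hne
    have hV : M.V β ψ φ 0 y = 0 := by
      simp [M.V_eq_payoff hβ hψφ 0, hne, payoff, discounted, hit_empty, hS0]
    refine hyD ((M.mem_D_iff hβ hψφ).2 ⟨Set.notMem_empty y, ?_⟩)
    exact le_antisymm (hV.trans_le (hψ y)) (M.le_V hβ hψφ 0 y)
  -- V_0(z) = ψ(z) ≤ φ(z), so z can belong to S_1 only through φ = ψ, and such states are kept.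
  have hz' : z ∉ M.S β ψ φ 1 \ M.S β ψ φ (k + 1) := by
    rintro ⟨hz1, hz2⟩
    have hVz := ((M.mem_D_iff hβ hψφ).1 hz).2
    rcases hz1 with h | h
    · rw [Set.mem_ofPred_eq, M.onePlayerValue_eq β ψ φ, hVz] at h
      exact absurd (hψφ z) (not_le.2 h)
    · exact hz2 (M.contact_subset_S β ψ φ k h)
  have hyz : y ≠ z := fun h => hyD (h ▸ hz)
  have hdisj : Disjoint (M.S β ψ φ 1 \ M.S β ψ φ (k + 1)) {y, z} := by
    rw [Set.disjoint_right]
    rintro w (rfl | rfl)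
    exacts [fun h => h.2 hyS, hz']
  rw [← Set.ncard_pair hyz, ← Set.ncard_union_eq hdisj, ← Nat.card_eq_fintype_card]
  exact Set.ncard_le_card _

lemma exists_stationary (hψ : ∀ x, 0 ≤ ψ x) :
    ∃ n, M.S β ψ φ (n + 2) = M.S β ψ φ (n + 1) ∧
      (2 ≤ Fintype.card E → n + 1 < Fintype.card E) ∧ (Fintype.card E ≤ 1 → n = 0) := by
  classical
  have hex : ∃ n, M.S β ψ φ (n + 2) = M.S β ψ φ (n + 1) := by
    by_contra! hne
    have h1 := M.le_ncard_S_diff β ψ φ (Fintype.card E + 1) fun i _ => hne i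
    have h2 := Set.ncard_le_card (M.S β ψ φ 1 \ M.S β ψ φ (Fintype.card E + 1 + 1))
    rw [Nat.card_eq_fintype_card] at h2
    omega
  have hn := M.le_ncard_S_diff β ψ φ (Nat.find hex) fun i hi => Nat.find_min hex hi
  refine ⟨Nat.find hex, Nat.find_spec hex, ?_⟩
  rcases (Nat.find hex).eq_zero_or_pos with h0 | hpos
  · exact ⟨fun h => by omega, fun _ => h0⟩
  -- At least n states have been removed and two others were not, so n + 2 ≤ |E|.
  · have h2 := M.ncard_S_diff_add_two_le hβ hψφ hψ (k := Nat.find hex) fun h => by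
      rw [h, Set.sdiff_self, Set.ncard_empty] at hn
      omega
    exact ⟨fun _ => by omega, fun _ => by omega⟩

/-- Stationarity means L V ≥ 0 on S outside {φ = ψ}, while L V = 0 off S ∪ D. So V is subharmonic
before τ*, equals ψ where τ* stops, and is at most φ wherever γ may stop. -/
lemma V_le_payoff_of_stationary {n : ℕ} (h : M.S β ψ φ (n + 2) = M.S β ψ φ (n + 1))
    {γ : Ω → WithTop ℝ≥0} (hγ : IsStoppingTime M.filtration γ) (x : E) :
    M.V β ψ φ (n + 1) x ≤
      M.payoff β ψ φ (M.hit (M.D β ψ φ (n + 1) ∪ {x | φ x = ψ x})) γ x := by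
  refine M.le_payoff hβ _ (M.isStoppingTime_hit _) hγ (fun ω t ht _ => ?_) (fun ω t ht _ => ?_)
    (fun ω t _ _ => M.V_le hβ hψφ n _) x
  · have hX := M.notMem_of_lt_hit ht
    by_cases hS : M.X t ω ∈ M.S β ψ φ (n + 1)
    · rw [← h] at hS
      exact hS.elim (fun h => h.2) fun h => absurd (.inr h) hX
    · exact (M.discountedGenerator_V_eq_zero hβ hψφ hS fun h => hX (.inl h)).ge
  · rcases M.mem_of_hit_eq ht with hX | hX
    · exact ((M.mem_D_iff hβ hψφ).1 hX).2.le
    · exact ((M.V_of_mem_S hβ hψφ (M.contact_subset_S β ψ φ n hX)).trans hX).le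

end

end MarkovChain

/-! ### The saddle point and the limit objects -/

theorem theorem3p7 {E Ω : Type*} [Fintype E] [MeasurableSpace E] [MeasurableSingletonClass E]
    [MeasurableSpace Ω] (Q : Matrix E E ℝ) (M : MarkovChain Ω Q) (β : ℝ) (hβ : 0 < β)
    (ψ φ : E → ℝ) (hψ : ∀ x, 0 ≤ ψ x) (hψφ : ∀ x, ψ x ≤ φ x) :
    -- the pair `(τ_∞ ∧ h({φ = ψ}), h(S_∞))` is a Nash equilibrium
    M.IsNashEquilibrium β ψ φ (M.hit (M.limD β ψ φ ∪ {x | φ x = ψ x})) (M.hit (M.limS β ψ φ)) ∧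
    (∀ ω, M.hit (M.limD β ψ φ ∪ {x | φ x = ψ x}) ω =
      min (M.hit (M.limD β ψ φ) ω) (M.hit {x | φ x = ψ x} ω)) ∧
    -- `V_k` decreases to `V_∞`, and `V_∞` is the value of the game
    (∀ k ≥ 1, ∀ x, M.V β ψ φ (k + 1) x ≤ M.V β ψ φ k x) ∧
    (∀ x, Tendsto (fun k => M.V β ψ φ k x) atTop (𝓝 (M.limV β ψ φ x))) ∧
    (∀ x, M.lowerValue β ψ φ x = M.limV β ψ φ x ∧ M.upperValue β ψ φ x = M.limV β ψ φ x) ∧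
    (∀ x ∈ M.limS β ψ φ, M.limV β ψ φ x = φ x) ∧
    (∀ x ∈ M.limD β ψ φ, M.limV β ψ φ x = ψ x ∧ ψ x < φ x) ∧
    -- the iteration is stationary from an index `N < |E|` on (`N = 1` if there is one state)
    ∃ N ≥ 1, (2 ≤ Fintype.card E → N < Fintype.card E) ∧ (Fintype.card E ≤ 1 → N = 1) ∧
      ∀ k ≥ N, M.S β ψ φ k = M.limS β ψ φ ∧ M.D β ψ φ k = M.limD β ψ φ ∧
        M.V β ψ φ k = M.limV β ψ φ := by
  obtain ⟨n, hn, hcard, hcard'⟩ := M.exists_stationary hβ hψφ hψ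
  have hSk : ∀ k ≥ n, M.S β ψ φ (k + 1) = M.S β ψ φ (n + 1) := fun k => M.S_eq_of_le β ψ φ hn
  have hVk : ∀ k ≥ n, M.V β ψ φ (k + 1) = M.V β ψ φ (n + 1) := fun k hk => by
    rw [MarkovChain.V, MarkovChain.V, hSk k hk]
  have hDk : ∀ k ≥ n, M.D β ψ φ (k + 1) = M.D β ψ φ (n + 1) := fun k hk => by
    ext x
    rw [M.mem_D_iff hβ hψφ, M.mem_D_iff hβ hψφ, hSk k hk, hVk k hk]
  have hVanti : ∀ x, Antitone fun k => M.V β ψ φ (k + 1) x := fun x =>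
    antitone_nat_of_succ_le fun k => M.V_succ_le hβ hψφ k x
  have hDmono : Monotone fun k => M.D β ψ φ (k + 1) :=
    monotone_nat_of_le_succ fun k => M.D_succ_subset hβ hψφ k
  have hlimS : M.limS β ψ φ = M.S β ψ φ (n + 1) := by
    refine Set.Subset.antisymm (Set.iInter₂_subset (n + 1) n.succ_pos)
      (Set.subset_iInter₂ fun k hk => ?_)
    obtain ⟨k, rfl⟩ := Nat.exists_eq_add_of_le' hk
    rcases le_total k n with h | h
    exacts [M.S_antitone β ψ φ h, (hSk k h).ge]
  have hlimD : M.limD β ψ φ = M.D β ψ φ (n + 1) := by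
    refine Set.Subset.antisymm (Set.iUnion₂_subset fun k hk => ?_)
      (Set.subset_iUnion₂_of_subset (n + 1) n.succ_pos subset_rfl)
    obtain ⟨k, rfl⟩ := Nat.exists_eq_add_of_le' hk
    rcases le_total k n with h | h
    exacts [hDmono h, (hDk k h).le]
  have hlow : ∀ k x, M.V β ψ φ (n + 1) x ≤ M.V β ψ φ (k + 1) x := fun k x => by
    rcases le_total k n with h | h
    exacts [hVanti x h, (congrFun (hVk k h) x).ge]
  have hlimV : M.limV β ψ φ = M.V β ψ φ (n + 1) := funext fun x =>
    le_antisymm (ciInf_le ⟨_, Set.forall_mem_range.2 fun k => hlow k x⟩ n)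
      (le_ciInf fun k => hlow k x)
  rw [hlimS, hlimD, hlimV]
  have hτ := M.isStoppingTime_hit (M.D β ψ φ (n + 1) ∪ {x | φ x = ψ x})
  have hγ := M.isStoppingTime_hit (M.S β ψ φ (n + 1))
  have hup : ∀ τ : M.StopTime, ∀ x,
      M.payoff β ψ φ τ.1 (M.hit (M.S β ψ φ (n + 1))) x ≤ M.V β ψ φ (n + 1) x := fun τ x =>
    M.payoff_le_bestResponse hβ ψ φ _ τ.2 x
  have hdown : ∀ γ : M.StopTime, ∀ x, M.V β ψ φ (n + 1) x ≤
      M.payoff β ψ φ (M.hit (M.D β ψ φ (n + 1) ∪ {x | φ x = ψ x})) γ.1 x := fun γ x =>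
    M.V_le_payoff_of_stationary hβ hψφ hn γ.2 x
  -- Both saddle inequalities pass through the value: R(τ, γ*) ≤ V ≤ R(τ*, γ), applied once with γ =
  -- γ* and once with τ = τ*.
  refine ⟨⟨hτ, hγ, fun τ γ h1 h2 x => ⟨(hup ⟨τ, h1⟩ x).trans (hdown ⟨_, hγ⟩ x),
      (hup ⟨_, hτ⟩ x).trans (hdown ⟨γ, h2⟩ x)⟩⟩, fun ω => M.hit_union _ _ ω, fun k hk x => ?_,
    fun x => ?_, fun x => ⟨?_, ?_⟩, fun x hx => M.V_of_mem_S hβ hψφ hx, fun x hx => ?_,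
    n + 1, n.succ_pos, hcard, fun h => by rw [hcard' h], fun k hk => ?_⟩
  · obtain ⟨k, rfl⟩ := Nat.exists_eq_add_of_le' hk
    exact M.V_succ_le hβ hψφ k x
  · rw [← tendsto_add_atTop_iff_nat 1]
    refine tendsto_const_nhds.congr' ?_
    filter_upwards [eventually_ge_atTop n] with k hk using by rw [hVk k hk]
  · have hinf : ∀ τ : M.StopTime,
        ⨅ γ : M.StopTime, M.payoff β ψ φ τ.1 γ.1 x ≤ M.V β ψ φ (n + 1) x := fun τ =>
      (ciInf_le (M.bddBelow_payoff hβ ψ φ τ.1 x) ⟨_, hγ⟩).trans (hup τ x)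
    exact le_antisymm (ciSup_le hinf) (le_ciSup_of_le ⟨_, Set.forall_mem_range.2 hinf⟩ ⟨_, hτ⟩
      (le_ciInf fun γ => hdown γ x))
  · have hsup : ∀ γ : M.StopTime,
        M.V β ψ φ (n + 1) x ≤ ⨆ τ : M.StopTime, M.payoff β ψ φ τ.1 γ.1 x := fun γ =>
      (hdown γ x).trans (le_ciSup (M.bddAbove_payoff hβ ψ φ γ.1 x) ⟨_, hτ⟩)
    exact le_antisymm (ciInf_le_of_le ⟨_, Set.forall_mem_range.2 hsup⟩ ⟨_, hγ⟩
      (ciSup_le fun τ => hup τ x)) (le_ciInf hsup)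
  · obtain ⟨hxS, hxV⟩ := (M.mem_D_iff hβ hψφ).1 hx
    exact ⟨hxV, (hψφ x).lt_of_ne fun h => hxS (M.contact_subset_S β ψ φ n h.symm)⟩
  · obtain ⟨k, rfl⟩ := Nat.exists_eq_add_of_le' (n.succ_pos.trans_le hk)
    have hk' : n ≤ k := Nat.le_of_succ_le_succ hk
    exact ⟨hSk k hk', hDk k hk', hVk k hk'⟩
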